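/- Let $m\ge 1$ and $n\ge 2$ be integers. Let $\widetilde A_{n-1}$ be the affine Coxeter group with simple reflections $r_0,\dots,r_{n-1}$ and $\widetilde A_{mn-1}$ the affine Coxeter group with simple reflections $s_0,\dots,s_{mn-1}$, each numbered cyclically along the Coxeter graph ($\widetilde A_{N-1}$ has a cycle with $N$ vertices as its Coxeter graph if $N\ge 3$, and $\widetilde A_1$ is the infinite dihedral group). Let $\ell_{n}$ and $\ell_{mn}$ be their length functions. Put $I_i=\{s_i,s_{i+n},\dots,s_{i+(m-1)n}\}$ for $0\le i<n$. (1) The partition $\{I_0,\dots,I_{n-1}\}$ of the simple reflections of $\widetilde A_{mn-1}$ is admissible: each parabolic subgroup $\langle I_i\rangle$ is finite and, if $\widehat W$ denotes the subgroup of $\widetilde A_{mn-1}$ generated by the longest elements of the $\langle I_i\rangle$, then for every $w\in\widehat W$ and every $i$ either $\ell_{mn}(ws)=\ell_{mn}(w)+1$ for all $s\in I_i$ or $\ell_{mn}(ws)=\ell_{mn}(w)-1$ for all $s\in I_i$. The unique longest element of $\langle I_i\rangle$ is $\prod_{j=0}^{m-1}s_{i+jn}$. (2) There is a (necessarily unique)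 group homomorphism $\phi:\widetilde A_{n-1}\to\widetilde A_{mn-1}$ with $\phi(r_i)=\prod_{j=0}^{m-1}s_{i+jn}$ for $0\le i<n$. It is injective, its image is $\widehat W$, and $$\ell_{mn}(\phi(w))=m\,\ell_{n}(w)\qquad\text{for all } w\in\widetilde A_{n-1}.$$ (3) Let $P(q)=\sum_{w\in\widetilde A_{n-1}}q^{\ell_n(w)}$ be the Poincaré series of $\widetilde A_{n-1}$ and $[k]_q=1+q+\dots+q^{k-1}$. Then, as formal power series in $q$, the unfolding series satisfies $$U(q):=\sum_{w\in\widetilde A_{n-1}}q^{\ell_{mn}(\phi(w))}=P(q^m)=\prod_{k=2}^{n}\frac{[k]_{q^m}}{1-q^{(k-1)m}}.$$ -/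

import Mathlib

open PowerSeries

namespace CoxeterFolding

/-! ### Foldings of a general Coxeter system -/

section General

variable {B W : Type*} [Group W] {M : CoxeterMatrix B}

/-- The parabolic subgroup `W_I` generated by the simple reflections indexed by `I`. -/
def parabolic (cs : CoxeterSystem M W) (I : Set B) : Subgroup W :=
  Subgroup.closure (cs.simple '' I)

/-- `w` is the (unique) element of maximal length of the parabolic subgroup `W_I`. -/
def IsLongest (cs : CoxeterSystem M W) (I : Set B) (w : W) : Prop :=
  w ∈ parabolic cs I ∧ ∀ u ∈ parabolic cs I, u ≠ w → cs.length u < cs.length w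

/-- The set `R` of the longest elements of the parabolic subgroups `W_I`, where `I` runs over the
blocks `p ⁻¹' {i}` of the partition of the simple reflections given by a map `p`. -/
def foldingGenerators {B' : Type*} (cs : CoxeterSystem M W) (p : B → B') : Set W :=
  {w | ∃ i : B', IsLongest cs (p ⁻¹' {i}) w}

/-- The subgroup of `W` generated by the longest elements of the blocks of the partition. -/
def foldingSubgroup {B' : Type*} (cs : CoxeterSystem M W) (p : B → B') : Subgroup W :=
  Subgroup.closure (foldingGenerators cs p)

/-- Admissibility of the partition of the simple reflections into the fibres of `p`:
the blocks are nonempty, they generate finite parabolic subgroups, and right multiplication of an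
element of the folding subgroup by the simple reflections of one block either always increases or
always decreases the length. -/
def IsAdmissible {B' : Type*} (cs : CoxeterSystem M W) (p : B → B') : Prop :=
  Function.Surjective p ∧
  (∀ i : B', (parabolic cs (p ⁻¹' {i}) : Set W).Finite) ∧
  ∀ w ∈ foldingSubgroup cs p, ∀ i : B',
    (∀ b ∈ p ⁻¹' {i}, cs.length (w * cs.simple b) = cs.length w + 1) ∨
    (∀ b ∈ p ⁻¹' {i}, cs.length (w * cs.simple b) + 1 = cs.length w)

/-- The unfolding series `∑_{w ∈ H} q ^ ℓ(φ w)` of a homomorphism `φ : H →* W`, as a formal power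
series in `q`: its coefficient at `q ^ d` is the number of `w : H` with `ℓ(φ w) = d`. That number
is finite for an injective `φ` and finitely many simple reflections, see
`finite_length_eq`. -/
noncomputable def unfoldingSeries {H : Type*} [Group H] (cs : CoxeterSystem M W) (φ : H →* W) :
    ℚ⟦X⟧ :=
  PowerSeries.mk fun d => (Nat.card {w : H // cs.length (φ w) = d} : ℚ)

/-- The Poincaré series `∑_{w ∈ W} q ^ ℓ(w)`. -/
noncomputable def poincareSeries (cs : CoxeterSystem M W) : ℚ⟦X⟧ :=
  PowerSeries.mk fun d => (Nat.card {w : W // cs.length w = d} : ℚ)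

/-- The counting problem in `unfoldingSeries` is finite. -/
theorem finite_length_eq [Finite B] {H : Type*} [Group H] (cs : CoxeterSystem M W)
    (φ : H →* W) (hφ : Function.Injective φ) (d : ℕ) :
    Finite {w : H // cs.length (φ w) = d} := by
  have h1 : {w : W | cs.length w = d}.Finite := by
    refine ((List.finite_length_eq B d).image cs.wordProd).subset ?_
    intro w hw
    obtain ⟨l, hl, rfl⟩ := cs.exists_isReduced w
    refine ⟨l, ?_, rfl⟩
    have h2 := hl.eq
    simp only [Set.mem_ofPred_eq] at hw ⊢
    omega
  exact (h1.preimage hφ.injOn).to_subtype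

end General

/-- The `q`-integer `[k]_q = 1 + q + ⋯ + q ^ (k - 1)`. -/
def qInt {A : Type*} [Semiring A] (k : ℕ) (q : A) : A :=
  ∑ j ∈ Finset.range k, q ^ j

/-! ### The affine type `A` and its folding -/

/-- The Coxeter matrix of affine type `Ã_{n-1}`, `n ≥ 2`, with the `n` simple reflections
indexed by `ℤ/nℤ`. For `n ≥ 3` the Coxeter graph is a cycle with `n` vertices; for `n = 2` it
consists of two vertices joined by an edge with label `∞` (which Mathlib encodes as `0`). -/
def affineA (n : ℕ) : CoxeterMatrix (ZMod n) where
  M := Matrix.of fun i j : ZMod n =>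
    if i = j then 1
    else if n = 2 then 0
    else if j = i + 1 ∨ i = j + 1 then 3
    else 2
  isSymm := by
    ext i j
    simp only [Matrix.transpose_apply, Matrix.of_apply, eq_comm (a := j) (b := i),
      or_comm (a := i = j + 1)]
  diagonal i := by simp
  off_diagonal i j h := by
    simp only [Matrix.of_apply, if_neg h]
    split_ifs <;> simp

/-- The standard Coxeter system of type `Ã_{n-1}`. -/
def csA (n : ℕ) : CoxeterSystem (affineA n) (affineA n).Group :=
  (affineA n).toCoxeterSystem

/-- The partition of the simple reflections of `Ã_{mn-1}` into the blocks
`{s_i, s_{i+n}, …, s_{i+(m-1)n}}`: reduction modulo `n` on indices. -/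
def foldMap (m n : ℕ) : ZMod (m * n) → ZMod n :=
  ZMod.castHom (Dvd.intro_left m rfl) (ZMod n)

/-- The product `s_i s_{i+n} ⋯ s_{i+(m-1)n}` in `Ã_{mn-1}`, where `0 ≤ i < n`. -/
def foldGen (m n : ℕ) (i : ZMod n) : (affineA (m * n)).Group :=
  ((List.range m).map fun j => (csA (m * n)).simple ((i.val + j * n : ℕ) : ZMod (m * n))).prod

end CoxeterFolding

/-! Elements of `Ã_{n-1}` are encoded by inversion tables `a : ZMod n → ℕ`. In the model by affine
permutations, `a k` counts the positions `j > k` with `w(j) < w(k)`, and right multiplication by the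
`i`-th simple reflection changes only `a i` and `a (i + 1)`, by `swapTable`. The proof works with
the Coxeter presentation: `swapTable` satisfies the defining relations, so the group acts on tables,
and `table w` comes from acting on the zero table.

The main facts are that `table` is injective (`table_injective`), that its image consists of the
tables with a zero entry, and that length is the sum of the entries (`length_eq_sum_table`). Right
descents of `w` are then the cyclic descents `a (i + 1) < a i`.

Folding becomes pullback along reduction mod `n`: the product over a block acts on a pulled-back
table as the pullback of `swapTable i` (`table_mul_foldGen`). By injectivity the block products
satisfy the relations of `Ã_{n-1}`, and `table (φ w) = table w ∘ foldMap`. Since the fibres have `m`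
elements, lengths are multiplied by `m`; injectivity and admissibility are read off the tables.
Counting tables with a zero gives `P(q) = (1 - q ^ n) / (1 - q) ^ n`. -/

namespace CoxeterFolding

/-! ### The action of the affine symmetric group on inversion tables -/

section Tables

variable {n : ℕ}

/-- The effect on the inversion table of an affine permutation of exchanging the values at the
positions `i` and `i + 1`. -/
def swapTable (i : ZMod n) (a : ZMod n → ℕ) : ZMod n → ℕ := fun k =>
  if k = i then (if a i ≤ a (i + 1) then a (i + 1) + 1 else a (i + 1))
  else if k = i + 1 then (if a i ≤ a (i + 1) then a i else a i - 1)
  else a k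

theorem swapTable_left (i : ZMod n) (a : ZMod n → ℕ) :
    swapTable i a i = if a i ≤ a (i + 1) then a (i + 1) + 1 else a (i + 1) := by
  simp [swapTable]

theorem swapTable_right [Fact (1 < n)] (i : ZMod n) (a : ZMod n → ℕ) :
    swapTable i a (i + 1) = if a i ≤ a (i + 1) then a i else a i - 1 := by
  simp [swapTable]

theorem swapTable_of_ne {i k : ZMod n} (a : ZMod n → ℕ) (h : k ≠ i) (h' : k ≠ i + 1) :
    swapTable i a k = a k := by
  simp [swapTable, h, h']

theorem swapTable_swapTable [Fact (1 < n)] (i : ZMod n) (a : ZMod n → ℕ) :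
    swapTable i (swapTable i a) = a := by
  funext k
  by_cases h : k = i
  · subst h
    rw [swapTable_left, swapTable_right, swapTable_left]
    split_ifs <;> omega
  by_cases h' : k = i + 1
  · subst h'
    rw [swapTable_right, swapTable_right, swapTable_left]
    split_ifs <;> omega
  rw [swapTable_of_ne _ h h', swapTable_of_ne _ h h']

theorem swapTable_comm {i j : ZMod n} (h1 : j ≠ i + 1) (h2 : i ≠ j + 1)
    (a : ZMod n → ℕ) : swapTable i (swapTable j a) = swapTable j (swapTable i a) := by
  by_cases h : i = j
  · rw [h]
  have h3 : i + 1 ≠ j + 1 := fun e => h (add_right_cancel e)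
  funext k
  simp only [swapTable, h, h1, h2, h3, Ne.symm h, Ne.symm h1, Ne.symm h2, Ne.symm h3, if_false]
  by_cases hi : k = i
  · subst hi; simp [h, h2]
  by_cases hj : k = j
  · subst hj; simp [hi, h1]
  simp only [hi, hj, if_false]
  by_cases hi' : k = i + 1
  · subst hi'; simp [h3]
  simp [hi']

theorem one_add_one_ne_zero_of_two_lt (h : 2 < n) : (1 + 1 : ZMod n) ≠ 0 := by
  intro e
  have h2 : ((2 : ℕ) : ZMod n) = 0 := by rw [← e]; norm_num
  have := Nat.le_of_dvd (by norm_num) ((ZMod.natCast_eq_zero_iff _ _).1 h2)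
  omega

theorem swapTable_braid [Fact (1 < n)] (h : 2 < n) (i : ZMod n) (a : ZMod n → ℕ) :
    swapTable i (swapTable (i + 1) (swapTable i a)) =
      swapTable (i + 1) (swapTable i (swapTable (i + 1) a)) := by
  have h2 := one_add_one_ne_zero_of_two_lt h
  have h3 : i + 1 + 1 ≠ i := by rw [add_assoc]; simpa using h2
  have h4 : i + 1 + 1 ≠ i + 1 := by simp
  have h5 : i + 1 ≠ i := by simp
  funext k
  by_cases k0 : k = i
  · subst k0
    simp only [swapTable, h3, h4, h5, h3.symm, h4.symm, h5.symm, if_false, if_true]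
    split_ifs <;> omega
  by_cases k1 : k = i + 1
  · subst k1
    simp only [swapTable, h3, h4, h5, h3.symm, h4.symm, h5.symm, if_false, if_true]
    split_ifs <;> omega
  by_cases k2 : k = i + 1 + 1
  · subst k2
    simp only [swapTable, h3, h4, h5, h3.symm, h4.symm, h5.symm, if_false, if_true]
    split_ifs <;> omega
  simp [swapTable, k0, k1, k2]

theorem sum_swapTable [NeZero n] [Fact (1 < n)] (i : ZMod n) (a : ZMod n → ℕ) :
    (a i ≤ a (i + 1) → ∑ k, swapTable i a k = ∑ k, a k + 1) ∧
      (a (i + 1) < a i → ∑ k, swapTable i a k + 1 = ∑ k, a k) := by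
  have key (b : ZMod n → ℕ) :
      ∑ k, b k = b i + (b (i + 1) + ∑ k ∈ (Finset.univ.erase i).erase (i + 1), b k) := by
    rw [Finset.add_sum_erase _ _ (by simp), Finset.add_sum_erase _ _ (by simp)]
  have hrest : ∑ k ∈ (Finset.univ.erase i).erase (i + 1), swapTable i a k =
      ∑ k ∈ (Finset.univ.erase i).erase (i + 1), a k := by
    refine Finset.sum_congr rfl fun k hk => swapTable_of_ne a ?_ ?_
    · exact Finset.ne_of_mem_erase (Finset.mem_of_mem_erase hk)
    · exact Finset.ne_of_mem_erase hk
  rw [key, key a, hrest, swapTable_left, swapTable_right]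
  constructor <;> intro h <;> split_ifs <;> omega

/-- A zero at `i` moves to `i + 1`, a zero at `i + 1` below a positive `a i` moves to `i`, and any
other zero stays put. -/
theorem exists_swapTable_eq_zero [Fact (1 < n)] {a : ZMod n → ℕ} (h : ∃ k, a k = 0)
    (i : ZMod n) : ∃ k, swapTable i a k = 0 := by
  obtain ⟨k, hk⟩ := h
  by_cases h0 : a i ≤ a (i + 1) ∧ a i = 0
  · exact ⟨i + 1, by rw [swapTable_right]; split_ifs <;> omega⟩
  by_cases h1 : a (i + 1) < a i ∧ a (i + 1) = 0
  · exact ⟨i, by rw [swapTable_left]; split_ifs <;> omega⟩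
  have hi : k ≠ i := by rintro rfl; omega
  have hi' : k ≠ i + 1 := by rintro rfl; omega
  exact ⟨k, by rw [swapTable_of_ne _ hi hi', hk]⟩

/-- Without a descent the table is weakly increasing along the cycle, so going round from any
position to the zero bounds its entry by `0`. -/
theorem exists_descent [NeZero n] {a : ZMod n → ℕ} (h : ∃ k, a k = 0) (h0 : a ≠ 0) :
    ∃ i, a (i + 1) < a i := by
  by_contra! hc
  obtain ⟨k, hk⟩ := h
  have step (k : ZMod n) (r : ℕ) : a k ≤ a (k + r) := by
    induction r with
    | zero => simp
    | succ r ih => exact ih.trans (by simpa [add_assoc] using hc (k + r))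
  refine h0 (funext fun l => ?_)
  have := step l (k - l).val
  rw [ZMod.natCast_rightInverse (k - l)] at this
  simp only [add_sub_cancel] at this
  simpa [hk] using this

/-- `swapTable` as a permutation of the set of tables. -/
def swapPerm [Fact (1 < n)] (i : ZMod n) : Equiv.Perm (ZMod n → ℕ) :=
  Function.Involutive.toPerm (swapTable i) (swapTable_swapTable i)

@[simp] theorem swapPerm_apply [Fact (1 < n)] (i : ZMod n) (a : ZMod n → ℕ) :
    swapPerm i a = swapTable i a := rfl

theorem mul_pow_three_eq_one {G : Type*} [Group G] {x y : G} (hx : x * x = 1) (hy : y * y = 1)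
    (h : x * y * x = y * x * y) : (x * y) ^ 3 = 1 := by
  calc (x * y) ^ 3 = (x * y * x) * (y * x * y) := by
        simp only [pow_succ, pow_zero, one_mul, mul_assoc]
    _ = y * (x * (y * y) * x) * y := by rw [h]; group
    _ = 1 := by simp [hx, hy]

theorem affineA_isLiftable_swapPerm [Fact (1 < n)] :
    (affineA n).IsLiftable (swapPerm : ZMod n → Equiv.Perm (ZMod n → ℕ)) := by
  have hsq (i : ZMod n) : swapPerm i * swapPerm i = 1 :=
    Equiv.ext fun a => swapTable_swapTable i a
  have hbraid (h : 2 < n) (i : ZMod n) :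
      swapPerm i * swapPerm (i + 1) * swapPerm i =
        swapPerm (i + 1) * swapPerm i * swapPerm (i + 1) :=
    Equiv.ext fun a => swapTable_braid h i a
  intro i j
  have hn : 1 < n := Fact.out
  change (swapPerm i * swapPerm j) ^ (if i = j then 1 else if n = 2 then 0
    else if j = i + 1 ∨ i = j + 1 then 3 else 2) = 1
  split_ifs with h1 h2 h3
  · rw [h1, pow_one, hsq]
  · rfl
  · have h : 2 < n := by omega
    rcases h3 with rfl | rfl
    · exact mul_pow_three_eq_one (hsq _) (hsq _) (hbraid h i)
    · exact mul_pow_three_eq_one (hsq _) (hsq _) (hbraid h j).symm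
  · push Not at h3
    have hc : swapPerm i * swapPerm j = swapPerm j * swapPerm i :=
      Equiv.ext fun a => swapTable_comm h3.1 h3.2 a
    calc (swapPerm i * swapPerm j) ^ 2 = (swapPerm i * swapPerm j) * (swapPerm i * swapPerm j) :=
          pow_two _
      _ = (swapPerm i * swapPerm j) * (swapPerm j * swapPerm i) := by rw [← hc]
      _ = swapPerm i * (swapPerm j * swapPerm j) * swapPerm i := by group
      _ = 1 := by rw [hsq, mul_one, hsq]

/-- The inversion table of an element of the affine symmetric group. -/
def table [Fact (1 < n)] (w : (affineA n).Group) : ZMod n → ℕ :=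
  (csA n).lift ⟨swapPerm, affineA_isLiftable_swapPerm⟩ w⁻¹ 0

@[simp] theorem table_one [Fact (1 < n)] : table (1 : (affineA n).Group) = 0 := by
  simp [table]

-- The inverse in `table` makes the last letter of a word act last.
@[simp] theorem table_mul_simple [Fact (1 < n)] (w : (affineA n).Group) (i : ZMod n) :
    table (w * (csA n).simple i) = swapTable i (table w) := by
  simp [table, CoxeterSystem.lift_apply_simple]

theorem exists_table_eq_zero [Fact (1 < n)] (w : (affineA n).Group) : ∃ k, table w k = 0 := by
  induction w using (csA n).simple_induction_right with
  | one => exact ⟨0, by simp⟩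
  | mul_simple_right w i ih => rw [table_mul_simple]; exact exists_swapTable_eq_zero ih i

theorem sum_table_le_length [NeZero n] [Fact (1 < n)] (w : (affineA n).Group) :
    ∑ k, table w k ≤ (csA n).length w := by
  have key (ω : List (ZMod n)) : ∑ k, table ((csA n).wordProd ω) k ≤ ω.length := by
    induction ω using List.reverseRecOn with
    | nil => simp
    | append_singleton ω i ih =>
      have h := sum_swapTable i (table ((csA n).wordProd ω))
      rw [CoxeterSystem.wordProd_append, CoxeterSystem.wordProd_singleton, table_mul_simple,
        List.length_append, List.length_singleton]
      omega
  obtain ⟨ω, hω, rfl⟩ := (csA n).exists_isReduced w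
  rw [hω.eq]
  exact key ω

/-- Swapping at a descent lowers the sum by one, so induction reaches the zero table. The word built
this way has as many letters as the sum, which is also a lower bound for the length. -/
theorem exists_length_eq_and_table_eq [NeZero n] [Fact (1 < n)] (a : ZMod n → ℕ)
    (h : ∃ k, a k = 0) : ∃ w, (csA n).length w = ∑ k, a k ∧ table w = a := by
  induction hd : ∑ k, a k generalizing a with
  | zero =>
    refine ⟨1, by simp, ?_⟩
    rw [table_one]
    funext k
    exact (Finset.sum_eq_zero_iff.1 hd k (Finset.mem_univ k)).symm
  | succ d ih =>
    obtain ⟨i, hi⟩ := exists_descent h (by rintro rfl; simp at hd)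
    have hs := (sum_swapTable i a).2 hi
    obtain ⟨w, hw, hwa⟩ := ih (swapTable i a) (exists_swapTable_eq_zero h i) (by omega)
    have ht : table (w * (csA n).simple i) = a := by
      rw [table_mul_simple, hwa, swapTable_swapTable]
    refine ⟨w * (csA n).simple i, ?_, ht⟩
    have h1 := sum_table_le_length (w * (csA n).simple i)
    rw [ht] at h1
    have h2 := (csA n).length_mul_simple w i
    omega

theorem simple_mul_simple_comm {i j : ZMod n} (hn : n ≠ 2) (h1 : j ≠ i + 1) (h2 : i ≠ j + 1) :
    (csA n).simple i * (csA n).simple j = (csA n).simple j * (csA n).simple i := by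
  by_cases h : i = j
  · rw [h]
  have hM : affineA n i j = 2 := by
    change (if i = j then 1 else if n = 2 then 0 else if j = i + 1 ∨ i = j + 1 then 3 else 2) = 2
    simp [h, hn, h1, h2]
  have := (csA n).wordProd_braidWord_eq i j
  simp only [CoxeterSystem.braidWord, hM, (affineA n).symmetric j i,
    CoxeterSystem.alternatingWord, List.concat_eq_append, List.nil_append, List.singleton_append,
    CoxeterSystem.wordProd_cons, CoxeterSystem.wordProd_nil, mul_one] at this
  exact this

theorem simple_braid (hn : 2 < n) (i : ZMod n) :
    (csA n).simple i * (csA n).simple (i + 1) * (csA n).simple i =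
      (csA n).simple (i + 1) * (csA n).simple i * (csA n).simple (i + 1) := by
  have : Fact (1 < n) := ⟨by omega⟩
  have hM : affineA n i (i + 1) = 3 := by
    change (if i = i + 1 then 1 else if n = 2 then 0
      else if i + 1 = i + 1 ∨ i = i + 1 + 1 then 3 else 2) = 3
    simp [hn.ne']
  have := (csA n).wordProd_braidWord_eq i (i + 1)
  simp only [CoxeterSystem.braidWord, hM, (affineA n).symmetric (i + 1) i,
    CoxeterSystem.alternatingWord, List.concat_eq_append, List.nil_append, List.cons_append,
    CoxeterSystem.wordProd_cons, CoxeterSystem.wordProd_nil, mul_one, ← mul_assoc] at this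
  exact this.symm

end Tables

/-! ### Length is the sum of the table, and the table determines the element. -/

section Length

variable {n : ℕ} [NeZero n] [Fact (1 < n)]

/-- An element whose length is the sum `d + 1` of its table is the product of such an element
and a simple reflection, which is a descent of the table. -/
theorem exists_eq_mul_simple {d : ℕ} {u : (affineA n).Group} (hu : (csA n).length u = d + 1)
    (hs : ∑ k, table u k = d + 1) :
    ∃ (i : ZMod n) (v : (affineA n).Group), u = v * (csA n).simple i ∧ (csA n).length v = d ∧
      ∑ k, table v k = d ∧ table v = swapTable i (table u) ∧ table u (i + 1) < table u i := by
  have hne : u ≠ 1 := by rintro rfl; simp at hu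
  obtain ⟨i, hi⟩ := (csA n).exists_rightDescent_of_ne_one hne
  rw [CoxeterSystem.isRightDescent_iff] at hi
  have h1 := sum_table_le_length (u * (csA n).simple i)
  have ht := table_mul_simple u i
  have h2 := sum_swapTable i (table u)
  have h3 : table u (i + 1) < table u i := by
    by_contra! hc
    rw [ht, h2.1 hc] at h1
    omega
  refine ⟨i, u * (csA n).simple i, by simp, by omega, ?_, ht, h3⟩
  have := h2.2 h3
  rw [ht]
  omega

/-- The braid case of the diamond argument: three consecutive decreasing entries can be sorted in
two ways, both ending at the table of one `x` of length `d - 2`. The two elements are `x` times the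
two sides of the braid relation. -/
theorem eq_of_table_eq_of_adjacent {d : ℕ}
    (ih : ∀ u v : (affineA n).Group, (csA n).length u = d → (csA n).length v = d →
      ∑ k, table u k = d → table u = table v → u = v)
    {u' v' : (affineA n).Group} {a : ZMod n → ℕ} (i : ZMod n)
    (ha : ∃ k, a k = 0) (hd : ∑ k, a k = d + 1)
    (hu : (csA n).length u' = d) (hv : (csA n).length v' = d)
    (hu' : table u' = swapTable i a) (hv' : table v' = swapTable (i + 1) a)
    (h1 : a (i + 1) < a i) (h2 : a (i + 1 + 1) < a (i + 1)) :
    u' * (csA n).simple i = v' * (csA n).simple (i + 1) := by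
  -- For `n = 2` the indices `i + 1 + 1` and `i` coincide, so `h1` and `h2` contradict each other.
  have hn : 2 < n := by
    have h1n : 1 < n := Fact.out
    by_contra! hc
    obtain rfl : n = 2 := by omega
    have h11 : (1 + 1 : ZMod 2) = 0 := rfl
    rw [add_assoc, h11, add_zero] at h2
    omega
  have hne : i + 1 + 1 ≠ i := by
    rw [add_assoc]; simpa using one_add_one_ne_zero_of_two_lt hn
  have e1 : swapTable i a (i + 1) = a i - 1 := by
    rw [swapTable_right, if_neg (by omega)]
  have e2 : swapTable i a (i + 1 + 1) = a (i + 1 + 1) := swapTable_of_ne _ hne (by simp)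
  have s1 := (sum_swapTable i a).2 h1
  have s2 := (sum_swapTable (i + 1) (swapTable i a)).2 (by omega)
  have f1 : swapTable (i + 1) a i = a i := swapTable_of_ne _ (by simp) hne.symm
  have f2 : swapTable (i + 1) a (i + 1) = a (i + 1 + 1) := by
    rw [swapTable_left, if_neg (by omega)]
  have t1 := (sum_swapTable (i + 1) a).2 h2
  have g1 : swapTable (i + 1) (swapTable i a) i = a (i + 1) := by
    rw [swapTable_of_ne _ (by simp) hne.symm, swapTable_left, if_neg (by omega)]
  have g2 : swapTable (i + 1) (swapTable i a) (i + 1) = a (i + 1 + 1) := by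
    rw [swapTable_left, e1, e2, if_neg (by omega)]
  have s3 := (sum_swapTable i (swapTable (i + 1) (swapTable i a))).2 (by omega)
  obtain ⟨x, hx, hxa⟩ := exists_length_eq_and_table_eq
    (swapTable i (swapTable (i + 1) (swapTable i a)))
    (exists_swapTable_eq_zero (exists_swapTable_eq_zero (exists_swapTable_eq_zero ha i) _) _)
  -- The product on the right has table `b` and length at most `d`, while the sum `d` of `b` bounds
  -- its length below; hence `ih` applies.
  have aux (p q : ZMod n) (b : ZMod n → ℕ) (w : (affineA n).Group) (hw : (csA n).length w = d)
      (hb : table w = b) (hbd : ∑ k, b k = d)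
      (hpq : table x = swapTable q (swapTable p b)) :
      w = x * (csA n).simple q * (csA n).simple p := by
    have ht : table (x * (csA n).simple q * (csA n).simple p) = b := by
      rw [table_mul_simple, table_mul_simple, hpq, swapTable_swapTable, swapTable_swapTable]
    refine ih _ _ hw ?_ (by rw [hb, hbd]) (by rw [hb, ht])
    have l1 := sum_table_le_length (x * (csA n).simple q * (csA n).simple p)
    rw [ht, hbd] at l1
    have l2 := (csA n).length_mul_simple x q
    have l3 := (csA n).length_mul_simple (x * (csA n).simple q) p
    omega
  rw [aux (i + 1) i _ u' hu hu' (by omega) hxa,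
    aux i (i + 1) _ v' hv hv' (by omega) (by rw [hxa, swapTable_braid hn]),
    mul_assoc, mul_assoc, mul_assoc, mul_assoc]
  congr 1
  simpa only [mul_assoc] using simple_braid hn i

/-- A diamond argument on `d`: final letters `i` and `j` of the two elements are both descents of
the common table. Equal letters cancel, adjacent ones are joined by the braid relation, and the
others by commutation through an `x` of length `d - 1`, where `u` and `v` have length `d + 1`. -/
theorem eq_of_table_eq_of_length {d : ℕ} (u v : (affineA n).Group) (hu : (csA n).length u = d)
    (hv : (csA n).length v = d) (hs : ∑ k, table u k = d) (h : table u = table v) : u = v := by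
  induction d generalizing u v with
  | zero => rw [(csA n).length_eq_zero_iff.1 hu, (csA n).length_eq_zero_iff.1 hv]
  | succ d ih =>
    obtain ⟨i, u', rfl, hu', su, tu, hi⟩ := exists_eq_mul_simple hu hs
    obtain ⟨j, v', rfl, hv', sv, tv, hj⟩ := exists_eq_mul_simple hv (h ▸ hs)
    have ha := exists_table_eq_zero (u' * (csA n).simple i)
    rw [← h] at tv hj
    generalize table (u' * (csA n).simple i) = a at *
    clear h hu hv
    by_cases hij : i = j
    · subst hij
      rw [ih u' v' hu' hv' su (tu.trans tv.symm)]
    by_cases h1 : j = i + 1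
    · subst h1
      exact eq_of_table_eq_of_adjacent ih i ha hs hu' hv' tu tv hi hj
    by_cases h2 : i = j + 1
    · subst h2
      exact (eq_of_table_eq_of_adjacent ih j ha hs hv' hu' tv tu hj hi).symm
    have hij' : i + 1 ≠ j + 1 := fun e => hij (add_right_cancel e)
    have hn : n ≠ 2 := by
      rintro rfl
      have hd : ∀ i j : ZMod 2, i ≠ j → j = i + 1 := by decide
      exact h1 (hd i j hij)
    have s2 := (sum_swapTable j (swapTable i a)).2 (by
      rw [swapTable_of_ne a (Ne.symm h2) hij'.symm, swapTable_of_ne a (Ne.symm hij) h1]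
      exact hj)
    rw [← tu, su] at s2
    obtain ⟨x, hx, hxa⟩ := exists_length_eq_and_table_eq (swapTable j (swapTable i a))
      (exists_swapTable_eq_zero (exists_swapTable_eq_zero ha _) _)
    rw [← tu] at hx
    have aux (p : ZMod n) (w : (affineA n).Group) (hw : (csA n).length w = d)
        (hwd : ∑ k, table w k = d) (hp : table x = swapTable p (table w)) :
        w = x * (csA n).simple p := by
      have ht : table (x * (csA n).simple p) = table w := by
        rw [table_mul_simple, hp, swapTable_swapTable]
      refine ih _ _ hw ?_ hwd ht.symm
      have l1 := sum_table_le_length (x * (csA n).simple p)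
      rw [ht, hwd] at l1
      have l2 := (csA n).length_mul_simple x p
      omega
    rw [aux j u' hu' su (by rw [hxa, tu]),
      aux i v' hv' sv (by rw [hxa, tv, swapTable_comm h1 h2]), mul_assoc, mul_assoc,
      simple_mul_simple_comm hn h1 h2]

/-- At an ascent the lower bound by the sum forces the length up. At a descent, take a shortest `x`
realising the swapped table; then `x` times the reflection has the table of `u`, so it equals `u`
and the length drops. -/
theorem length_eq_sum_table (w : (affineA n).Group) : (csA n).length w = ∑ k, table w k := by
  induction w using (csA n).simple_induction_right with
  | one => simp
  | mul_simple_right u i ih =>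
    have h := sum_swapTable i (table u)
    rw [← table_mul_simple] at h
    have hl := (csA n).length_mul_simple u i
    have hle := sum_table_le_length (u * (csA n).simple i)
    rcases le_or_gt (table u i) (table u (i + 1)) with hi | hi
    · have := h.1 hi
      omega
    · have h2 := h.2 hi
      obtain ⟨x, hx, hxa⟩ := exists_length_eq_and_table_eq (table (u * (csA n).simple i))
        (exists_table_eq_zero _)
      have ht : table (x * (csA n).simple i) = table u := by
        rw [table_mul_simple, hxa, table_mul_simple, swapTable_swapTable]
      have l1 := sum_table_le_length (x * (csA n).simple i)
      rw [ht] at l1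
      have l2 := (csA n).length_mul_simple x i
      have hux : u = x * (csA n).simple i :=
        eq_of_table_eq_of_length u _ ih (by omega) rfl ht.symm
      have hxu : u * (csA n).simple i = x := by
        rw [hux, CoxeterSystem.simple_mul_simple_cancel_right]
      rw [← hx, hxu]

theorem table_injective : Function.Injective (table : (affineA n).Group → ZMod n → ℕ) :=
  fun u v h => eq_of_table_eq_of_length u v rfl
    (by rw [length_eq_sum_table, length_eq_sum_table, h]) (length_eq_sum_table u).symm h

/-- The right descents of `w` are the descents of its inversion table. -/
theorem length_mul_simple_of_le {w : (affineA n).Group} {i : ZMod n}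
    (h : table w i ≤ table w (i + 1)) :
    (csA n).length (w * (csA n).simple i) = (csA n).length w + 1 := by
  rw [length_eq_sum_table, length_eq_sum_table, table_mul_simple, (sum_swapTable i _).1 h]

theorem length_mul_simple_of_lt {w : (affineA n).Group} {i : ZMod n}
    (h : table w (i + 1) < table w i) :
    (csA n).length (w * (csA n).simple i) + 1 = (csA n).length w := by
  rw [length_eq_sum_table, length_eq_sum_table, table_mul_simple, (sum_swapTable i _).2 h]

end Length

/-! ### Block products, the folding homomorphism and admissibility. -/

section Folding

variable {m n : ℕ}

theorem foldMap_natCast (t : ℕ) : foldMap m n (t : ZMod (m * n)) = t :=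
  map_natCast (ZMod.castHom (Dvd.intro_left m rfl) (ZMod n)) t

theorem foldMap_add_one (k : ZMod (m * n)) : foldMap m n (k + 1) = foldMap m n k + 1 := by
  simp [foldMap]

theorem foldMap_surjective : Function.Surjective (foldMap m n) :=
  ZMod.ringHom_surjective (ZMod.castHom (Dvd.intro_left m rfl) (ZMod n))

/-- The indices `i, i + n, …, i + (m - 1) n` of a block. -/
def blockList (m n : ℕ) (i : ZMod n) : List (ZMod (m * n)) :=
  (List.range m).map fun j => ((i.val + j * n : ℕ) : ZMod (m * n))

theorem foldGen_eq_wordProd (i : ZMod n) :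
    foldGen m n i = (csA (m * n)).wordProd (blockList m n i) := by
  simp [foldGen, CoxeterSystem.wordProd, blockList, Function.comp_def]

theorem mem_blockList [NeZero n] [NeZero (m * n)] {i : ZMod n} {k : ZMod (m * n)} :
    k ∈ blockList m n i ↔ foldMap m n k = i := by
  simp only [blockList, List.mem_map, List.mem_range]
  constructor
  · rintro ⟨j, _, rfl⟩
    rw [foldMap_natCast]
    simp
  · rintro rfl
    refine ⟨k.val / n, ?_, ?_⟩
    · exact (Nat.div_lt_iff_lt_mul (NeZero.pos n)).2 k.val_lt
    · have : (foldMap m n k).val = k.val % n := by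
        conv_lhs => rw [← ZMod.natCast_zmod_val k, foldMap_natCast, ZMod.val_natCast]
      rw [this, mul_comm (k.val / n), Nat.mod_add_div, ZMod.natCast_zmod_val]

theorem nodup_blockList [NeZero n] [NeZero (m * n)] (i : ZMod n) :
    (blockList m n i).Nodup := by
  refine List.Nodup.map_on ?_ List.nodup_range
  intro x hx y hy h
  have hlt (z : ℕ) (hz : z ∈ List.range m) : i.val + z * n < m * n := by
    have h1 := i.val_lt
    have h2 : z + 1 ≤ m := List.mem_range.1 hz
    have h3 := Nat.mul_le_mul_right n h2
    rw [add_mul, one_mul] at h3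
    omega
  have h' := congrArg ZMod.val h
  rw [ZMod.val_cast_of_lt (hlt x hx), ZMod.val_cast_of_lt (hlt y hy)] at h'
  exact Nat.eq_of_mul_eq_mul_right (NeZero.pos n) (by omega)

theorem sum_comp_foldMap [NeZero n] [NeZero (m * n)] (a : ZMod n → ℕ) :
    ∑ k, a (foldMap m n k) = m * ∑ i, a i := by
  rw [← Finset.sum_fiberwise (s := Finset.univ) (g := foldMap m n), Finset.mul_sum]
  refine Finset.sum_congr rfl fun i _ => ?_
  have hcard : (Finset.univ.filter fun k => foldMap m n k = i).card = m := by
    have : (Finset.univ.filter fun k => foldMap m n k = i) = (blockList m n i).toFinset := by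
      ext k
      simp [mem_blockList]
    rw [this, List.toFinset_card_of_nodup (nodup_blockList i)]
    simp [blockList]
  rw [Finset.sum_congr rfl (g := fun _ => a i) (fun k hk => by rw [(Finset.mem_filter.1 hk).2]),
    Finset.sum_const, hcard, smul_eq_mul]

variable [Fact (1 < n)] [Fact (1 < m * n)]

/-- Since `1 < n`, the pairs `{j, j + 1}` for `j` in one block are disjoint, so the factors act
independently. Arbitrary sublists of the block are allowed in order to induct on partial products.
-/
theorem table_mul_wordProd {i : ZMod n} {a : ZMod n → ℕ} {w : (affineA (m * n)).Group}
    (hw : table w = a ∘ foldMap m n) (L : List (ZMod (m * n)))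
    (hL : ∀ k ∈ L, foldMap m n k = i) (hnd : L.Nodup) (k : ZMod (m * n)) :
    table (w * (csA (m * n)).wordProd L) k =
      if k ∈ L ∨ k - 1 ∈ L then swapTable i a (foldMap m n k) else a (foldMap m n k) := by
  induction L using List.reverseRecOn generalizing k with
  | nil => simp [hw]
  | append_singleton L j ih =>
    have hj : foldMap m n j = i := hL j (by simp)
    have hjL : j ∉ L := fun h => by
      rw [List.nodup_append] at hnd
      exact hnd.2.2 j h j (by simp) rfl
    have ih := ih (fun k hk => hL k (by simp [hk])) hnd.of_append_left
    have hL' (k : ZMod (m * n)) (hk : k ∈ L) : foldMap m n k = i := hL k (by simp [hk])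
    have h1 : j - 1 ∉ L := fun h => by
      have := foldMap_add_one (j - 1)
      rw [sub_add_cancel, hj, hL' _ h] at this
      simp at this
    have h2 : j + 1 ∉ L := fun h => by
      have := foldMap_add_one j
      rw [hL' _ h, hj] at this
      simp at this
    have e1 : table (w * (csA (m * n)).wordProd L) j = a i := by
      rw [ih, if_neg (by simp [hjL, h1]), hj]
    have e2 : table (w * (csA (m * n)).wordProd L) (j + 1) = a (i + 1) := by
      rw [ih, if_neg (by simp [hjL, h2]), foldMap_add_one, hj]
    rw [CoxeterSystem.wordProd_append, CoxeterSystem.wordProd_singleton, ← mul_assoc,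
      table_mul_simple]
    by_cases hk : k = j
    · subst hk
      have hk : k ∈ L ++ [k] ∨ k - 1 ∈ L ++ [k] := by simp
      rw [swapTable_left, e1, e2, if_pos hk, hj, swapTable_left]
    by_cases hk' : k = j + 1
    · subst hk'
      have hk : j + 1 ∈ L ++ [j] ∨ j + 1 - 1 ∈ L ++ [j] := by simp
      rw [swapTable_right, e1, e2, if_pos hk, foldMap_add_one, hj, swapTable_right]
    have hk'' : k - 1 ≠ j := fun h => hk' (by rw [← h, sub_add_cancel])
    rw [swapTable_of_ne _ hk hk', ih]
    simp [hk, hk'']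

/-- The product over a block acts on tables that are constant on blocks like the corresponding
simple reflection of the folded group. -/
theorem table_mul_foldGen [NeZero n] [NeZero (m * n)] {a : ZMod n → ℕ}
    {w : (affineA (m * n)).Group} (hw : table w = a ∘ foldMap m n) (i : ZMod n) :
    table (w * foldGen m n i) = swapTable i a ∘ foldMap m n := by
  funext k
  rw [foldGen_eq_wordProd, table_mul_wordProd (i := i) hw _ (fun k hk => mem_blockList.1 hk)
    (nodup_blockList i), Function.comp_apply]
  simp only [mem_blockList]
  split_ifs with h
  · rfl
  · push Not at h
    refine (swapTable_of_ne a h.1 fun e => h.2 ?_).symm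
    have := foldMap_add_one (k - 1)
    rw [sub_add_cancel, e] at this
    exact (add_right_cancel this).symm

theorem table_foldGen [NeZero n] [NeZero (m * n)] (i : ZMod n) :
    table (foldGen m n i) = Pi.single i 1 ∘ foldMap m n := by
  have h := table_mul_foldGen (m := m) (n := n) (a := 0) (w := 1) (by simp) i
  rw [one_mul] at h
  rw [h]
  congr 1
  funext k
  by_cases h1 : k = i
  · subst h1
    simp [swapTable_left]
  by_cases h2 : k = i + 1
  · subst h2
    simp [swapTable_right]
  simp [swapTable_of_ne _ h1 h2, h1]

/-- Each relator has the pullback of the table of the corresponding trivial relator, which is zero,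
so it is trivial by `table_injective`. -/
theorem affineA_isLiftable_foldGen [NeZero n] [NeZero (m * n)] :
    (affineA n).IsLiftable (foldGen m n) := by
  intro i j
  have key (r : ℕ) : table ((foldGen m n i * foldGen m n j) ^ r) =
      table (((csA n).simple i * (csA n).simple j) ^ r) ∘ foldMap m n := by
    induction r with
    | zero => simp
    | succ r ih =>
      rw [pow_succ, pow_succ, ← mul_assoc, ← mul_assoc, table_mul_simple, table_mul_simple]
      exact table_mul_foldGen (table_mul_foldGen ih i) j
  apply table_injective
  rw [key, CoxeterSystem.simple_mul_simple_pow]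
  simp

/-- The embedding of `Ã_{n-1}` into `Ã_{mn-1}` as the folding subgroup. -/
noncomputable def foldHom (m n : ℕ) [Fact (1 < n)] [Fact (1 < m * n)] [NeZero n]
    [NeZero (m * n)] : (affineA n).Group →* (affineA (m * n)).Group :=
  (csA n).lift ⟨foldGen m n, affineA_isLiftable_foldGen⟩

/-- Each generator toggles one entry of its block between `0` and `1`, the next entry being `0`
before and after. This bound gives both finiteness of the parabolic subgroup and maximality of
`foldGen`, whose table attains it everywhere. -/
theorem table_of_mem_parabolic {i : ZMod n} {u : (affineA (m * n)).Group}
    (hu : u ∈ parabolic (csA (m * n)) (foldMap m n ⁻¹' {i})) (k : ZMod (m * n)) :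
    table u k ≤ (Pi.single i 1 : ZMod n → ℕ) (foldMap m n k) := by
  have step (x : (affineA (m * n)).Group) (j : ZMod (m * n)) (hj : foldMap m n j = i)
      (hx : ∀ k, table x k ≤ (Pi.single i 1 : ZMod n → ℕ) (foldMap m n k)) (k : ZMod (m * n)) :
      table (x * (csA (m * n)).simple j) k ≤ (Pi.single i 1 : ZMod n → ℕ) (foldMap m n k) := by
    have h1 := hx j
    have h2 := hx (j + 1)
    rw [foldMap_add_one, hj, Pi.single_eq_of_ne (by simp)] at h2
    rw [hj, Pi.single_eq_same] at h1
    rw [table_mul_simple]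
    by_cases hk : k = j
    · subst hk
      rw [swapTable_left, hj, Pi.single_eq_same]
      split_ifs <;> omega
    by_cases hk' : k = j + 1
    · subst hk'
      rw [swapTable_right, foldMap_add_one, hj, Pi.single_eq_of_ne (by simp)]
      split_ifs <;> omega
    rw [swapTable_of_ne _ hk hk']
    exact hx k
  revert k
  induction hu using Subgroup.closure_induction_right with
  | one => simp
  | mul_right x _ y hy ih =>
    obtain ⟨j, hj, rfl⟩ := hy
    exact step x j hj ih
  | mul_inv_cancel x _ y hy ih =>
    obtain ⟨j, hj, rfl⟩ := hy
    rw [CoxeterSystem.inv_simple]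
    exact step x j hj ih

theorem finite_parabolic [NeZero (m * n)] (i : ZMod n) :
    (parabolic (csA (m * n)) (foldMap m n ⁻¹' {i}) : Set (affineA (m * n)).Group).Finite :=
  ((Set.finite_Iic ((Pi.single i 1 : ZMod n → ℕ) ∘ foldMap m n)).preimage
    table_injective.injOn).subset fun _ hu k => table_of_mem_parabolic hu k

variable [NeZero n] [NeZero (m * n)]

theorem foldHom_simple (i : ZMod n) : foldHom m n ((csA n).simple i) = foldGen m n i :=
  CoxeterSystem.lift_apply_simple _ affineA_isLiftable_foldGen i

theorem table_foldHom (w : (affineA n).Group) :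
    table (foldHom m n w) = table w ∘ foldMap m n := by
  induction w using (csA n).simple_induction_right with
  | one => simp
  | mul_simple_right w i ih =>
    rw [map_mul, foldHom_simple, table_mul_foldGen ih, table_mul_simple]

theorem length_foldHom (w : (affineA n).Group) :
    (csA (m * n)).length (foldHom m n w) = m * (csA n).length w := by
  rw [length_eq_sum_table, length_eq_sum_table, table_foldHom, ← sum_comp_foldMap]
  rfl

theorem foldHom_injective : Function.Injective (foldHom m n) := fun u v h => by
  have h' := congrArg table h
  rw [table_foldHom, table_foldHom] at h'
  exact table_injective (foldMap_surjective.injective_comp_right h')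

theorem isLongest_foldGen (i : ZMod n) :
    IsLongest (csA (m * n)) (foldMap m n ⁻¹' {i}) (foldGen m n i) := by
  constructor
  · rw [foldGen_eq_wordProd]
    refine Subgroup.list_prod_mem _ fun x hx => ?_
    obtain ⟨k, hk, rfl⟩ := List.mem_map.1 hx
    exact Subgroup.subset_closure ⟨k, mem_blockList.1 hk, rfl⟩
  · intro u hu hne
    have hle : table u ≤ table (foldGen m n i) := fun k => by
      rw [table_foldGen]
      exact table_of_mem_parabolic hu k
    obtain ⟨k, hk⟩ := (Pi.lt_def.1 (lt_of_le_of_ne hle (table_injective.ne hne))).2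
    rw [length_eq_sum_table, length_eq_sum_table]
    exact Finset.sum_lt_sum (fun k _ => hle k) ⟨k, Finset.mem_univ k, hk⟩

theorem IsLongest.unique {B W : Type*} [Group W] {M : CoxeterMatrix B} {cs : CoxeterSystem M W}
    {I : Set B} {u v : W} (hu : IsLongest cs I u) (hv : IsLongest cs I v) : u = v := by
  by_contra h
  exact lt_asymm (hu.2 v hv.1 (Ne.symm h)) (hv.2 u hu.1 h)

theorem foldingGenerators_eq :
    foldingGenerators (csA (m * n)) (foldMap m n) = Set.range (foldGen m n) := by
  ext w
  constructor
  · rintro ⟨i, hi⟩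
    exact ⟨i, (isLongest_foldGen i).unique hi⟩
  · rintro ⟨i, rfl⟩
    exact ⟨i, isLongest_foldGen i⟩

theorem range_foldHom :
    (foldHom m n).range = foldingSubgroup (csA (m * n)) (foldMap m n) := by
  rw [foldingSubgroup, foldingGenerators_eq, MonoidHom.range_eq_map,
    ← (csA n).subgroup_closure_range_simple, MonoidHom.map_closure, ← Set.range_comp]
  congr 2
  funext i
  exact foldHom_simple i

/-- A table pulled back from `ZMod n` has the same comparison between `b` and `b + 1` for every `b`
in a block, so the block consists entirely of ascents or entirely of descents. -/
theorem isAdmissible_foldMap : IsAdmissible (csA (m * n)) (foldMap m n) := by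
  refine ⟨foldMap_surjective, finite_parabolic, fun w hw i => ?_⟩
  rw [← range_foldHom] at hw
  obtain ⟨w, rfl⟩ := hw
  have ht (b : ZMod (m * n)) (hb : b ∈ foldMap m n ⁻¹' {i}) :
      table (foldHom m n w) b = table w i ∧ table (foldHom m n w) (b + 1) = table w (i + 1) := by
    rw [Set.mem_preimage, Set.mem_singleton_iff] at hb
    rw [table_foldHom, Function.comp_apply, Function.comp_apply, foldMap_add_one, hb]
    exact ⟨rfl, rfl⟩
  rcases le_or_gt (table w i) (table w (i + 1)) with h | h
  · exact Or.inl fun b hb => length_mul_simple_of_le (by rwa [(ht b hb).1, (ht b hb).2])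
  · exact Or.inr fun b hb => length_mul_simple_of_lt (by rwa [(ht b hb).1, (ht b hb).2])

end Folding

/-! ### Counting tables and the product formula. -/

section Series

/-- Folding substitutes `q ^ m` for `q` in the Poincaré series. -/
theorem unfoldingSeries_eq_expand {B B' W H : Type*} [Group W] [Group H] {M : CoxeterMatrix B}
    {M' : CoxeterMatrix B'} (cs : CoxeterSystem M W) (cs' : CoxeterSystem M' H) (φ : H →* W)
    {m : ℕ} (hm : m ≠ 0) (h : ∀ w, cs.length (φ w) = m * cs'.length w) :
    unfoldingSeries cs φ = PowerSeries.expand m hm (poincareSeries cs') := by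
  ext d
  simp only [unfoldingSeries, coeff_mk, h]
  by_cases hd : m ∣ d
  · obtain ⟨e, rfl⟩ := hd
    rw [coeff_expand_mul, poincareSeries, coeff_mk]
    simp only [mul_right_inj' hm]
  · rw [coeff_expand_of_not_dvd m hm _ hd]
    have : IsEmpty {w : H // m * cs'.length w = d} := ⟨fun w => hd ⟨_, w.2.symm⟩⟩
    simp

/-- Subtracting `1` from every entry identifies the zero-free tables of sum `d` with all tables of
sum `d - Fintype.card ι`. The `if` guards the truncated subtraction. -/
theorem card_exists_eq_zero_add {ι : Type*} [Fintype ι] [DecidableEq ι] (d : ℕ) :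
    ((Finset.piAntidiag (Finset.univ : Finset ι) d).filter fun a => ∃ k, a k = 0).card +
        (if Fintype.card ι ≤ d then
          (Finset.piAntidiag (Finset.univ : Finset ι) (d - Fintype.card ι)).card else 0) =
      (Finset.piAntidiag (Finset.univ : Finset ι) d).card := by
  rw [← Finset.card_filter_add_card_filter_not (s := Finset.piAntidiag Finset.univ d)
    (fun a => ∃ k, a k = 0)]
  congr 1
  have hsum (a : ι → ℕ) : ∑ k, (a k + 1) = ∑ k, a k + Fintype.card ι := by
    simp [Finset.sum_add_distrib]
  split_ifs with h
  · refine Finset.card_nbij' (fun a k => a k + 1) (fun a k => a k - 1) ?_ ?_ ?_ ?_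
    · intro a ha
      have ha' : ∑ k, a k = d - Fintype.card ι := by simpa using ha
      simp [hsum, ha', h]
    · intro a ha
      simp only [Finset.coe_filter, Finset.mem_piAntidiag, Set.mem_ofPred_eq, not_exists,
        Finset.mem_univ, implies_true, and_true] at ha
      have := hsum fun k => a k - 1
      have h1 (k : ι) : a k - 1 + 1 = a k := Nat.succ_pred (ha.2 k)
      simp only [h1, ha.1] at this
      simp only [Finset.mem_coe, Finset.mem_piAntidiag, Finset.mem_univ, implies_true, and_true]
      omega
    · intro a _
      simp
    · intro a ha
      simp only [Finset.coe_filter, Finset.mem_piAntidiag, Set.mem_ofPred_eq, not_exists,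
        Finset.mem_univ, implies_true, and_true] at ha
      funext k
      exact Nat.succ_pred (ha.2 k)
  · symm
    rw [Finset.card_eq_zero, Finset.filter_eq_empty_iff]
    intro a ha
    by_contra! hc
    have := hsum fun k => a k - 1
    have h1 (k : ι) : a k - 1 + 1 = a k := Nat.succ_pred (hc k)
    simp only [h1] at this
    simp only [Finset.mem_piAntidiag, Finset.mem_univ, implies_true, and_true] at ha
    change ∑ k, a k = d at ha
    omega

theorem mk_card_piAntidiag_mul_one_sub_X_pow (ι : Type*) [Fintype ι] [DecidableEq ι] :
    (PowerSeries.mk fun d => ((Finset.piAntidiag (Finset.univ : Finset ι) d).card : ℚ)) *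
      (1 - X) ^ Fintype.card ι = 1 := by
  have h : (PowerSeries.mk fun d => ((Finset.piAntidiag (Finset.univ : Finset ι) d).card : ℚ)) =
      ∏ _j : ι, (PowerSeries.mk 1 : ℚ⟦X⟧) := by
    ext d
    rw [coeff_prod]
    simp [Finset.finsuppAntidiag]
  rw [h, Finset.prod_const, Finset.card_univ, ← mul_pow, mk_one_mul_one_sub_eq_one, one_pow]

theorem natCard_length_eq {n : ℕ} [NeZero n] [Fact (1 < n)] (d : ℕ) :
    Nat.card {w : (affineA n).Group // (csA n).length w = d} =
      ((Finset.piAntidiag (Finset.univ : Finset (ZMod n)) d).filter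
        fun a => ∃ k, a k = 0).card := by
  rw [← Nat.subtype_card (p := fun a : ZMod n → ℕ => ∑ k, a k = d ∧ ∃ k, a k = 0) _
    (fun a => by simp)]
  refine Nat.card_eq_of_bijective
    (fun w => ⟨table w.1, by rw [← length_eq_sum_table, w.2], exists_table_eq_zero w.1⟩) ⟨?_, ?_⟩
  · intro u v h
    exact Subtype.ext (table_injective (congrArg Subtype.val h))
  · rintro ⟨a, ha, h0⟩
    obtain ⟨w, hw, hwa⟩ := exists_length_eq_and_table_eq a h0
    exact ⟨⟨w, hw.trans ha⟩, Subtype.ext hwa⟩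

/-- The Poincaré series of `Ã_{n-1}` is `(1 - q ^ n) / (1 - q) ^ n`. -/
theorem poincareSeries_mul_one_sub_X_pow {n : ℕ} [NeZero n] [Fact (1 < n)] :
    poincareSeries (csA n) * (1 - X) ^ n = 1 - X ^ n := by
  have h : poincareSeries (csA n) =
      (PowerSeries.mk fun d => ((Finset.piAntidiag (Finset.univ : Finset (ZMod n)) d).card : ℚ)) *
        (1 - X ^ n) := by
    ext d
    rw [poincareSeries, coeff_mk, natCard_length_eq, mul_sub, mul_one, map_sub, coeff_mul_X_pow',
      coeff_mk, ← card_exists_eq_zero_add, ZMod.card]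
    split_ifs <;> simp
  have h1 := mk_card_piAntidiag_mul_one_sub_X_pow (ZMod n)
  rw [ZMod.card] at h1
  rw [h, mul_right_comm, h1, one_mul]

theorem qInt_mul_one_sub {A : Type*} [CommRing A] (k : ℕ) (q : A) :
    qInt k q * (1 - q) = 1 - q ^ k := by
  rw [qInt, geom_sum_mul_neg]

/-- The product telescopes: after multiplication by `1 - X ^ m`, the factor at `k` is `(1 - X ^ (k *
m)) / (1 - X ^ ((k - 1) * m))`. -/
theorem prod_qInt_mul_one_sub_pow (m n : ℕ) (hm : m ≠ 0) (hn : 1 ≤ n) :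
    (∏ k ∈ Finset.Icc 2 n, qInt k ((X : ℚ⟦X⟧) ^ m) * (1 - (X : ℚ⟦X⟧) ^ ((k - 1) * m))⁻¹) *
      (1 - X ^ m) ^ n = 1 - (X ^ m) ^ n := by
  induction n, hn using Nat.le_induction with
  | base => simp
  | succ n hn ih =>
    have hne : constantCoeff (1 - (X : ℚ⟦X⟧) ^ (n * m)) ≠ 0 := by
      have : n * m ≠ 0 := by positivity
      simp [this]
    rw [Finset.prod_Icc_succ_top (by omega), pow_succ, Nat.add_sub_cancel]
    calc _ = (∏ k ∈ Finset.Icc 2 n,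
            qInt k ((X : ℚ⟦X⟧) ^ m) * (1 - (X : ℚ⟦X⟧) ^ ((k - 1) * m))⁻¹) * (1 - X ^ m) ^ n *
            (1 - X ^ (n * m))⁻¹ * (qInt (n + 1) (X ^ m) * (1 - X ^ m)) := by ring
      _ = _ := by
        rw [ih, qInt_mul_one_sub, ← pow_mul, mul_comm m n, PowerSeries.mul_inv_cancel _ hne,
          one_mul]

end Series

end CoxeterFolding

open CoxeterFolding in
theorem theorem1p6 (m n : ℕ) (hm : m ≠ 0) (hn : 2 ≤ n) :
    -- the blocks form an admissible partition, with longest elements `∏_j s_{i+jn}`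
    IsAdmissible (csA (m * n)) (foldMap m n) ∧
    (∀ i : ZMod n, IsLongest (csA (m * n)) (foldMap m n ⁻¹' {i}) (foldGen m n i)) ∧
    -- the folding subgroup is a copy of `Ã_{n-1}`, embedded by `φ`
    ∃ φ : (affineA n).Group →* (affineA (m * n)).Group,
      (∀ i : ZMod n, φ ((csA n).simple i) = foldGen m n i) ∧
      Function.Injective φ ∧
      φ.range = foldingSubgroup (csA (m * n)) (foldMap m n) ∧
      -- lengths are multiplied by `m`
      (∀ w : (affineA n).Group, (csA (m * n)).length (φ w) = m * (csA n).length w) ∧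
      -- the unfolding series is the Poincaré series at `q ^ m`, with its product formula
      unfoldingSeries (csA (m * n)) φ = PowerSeries.expand m hm (poincareSeries (csA n)) ∧
      unfoldingSeries (csA (m * n)) φ =
        ∏ k ∈ Finset.Icc 2 n,
          qInt k ((PowerSeries.X : PowerSeries ℚ) ^ m) *
            (1 - (PowerSeries.X : PowerSeries ℚ) ^ ((k - 1) * m))⁻¹ := by
  have hmn : 1 < m * n := lt_of_lt_of_le hn (Nat.le_mul_of_pos_left n (Nat.pos_of_ne_zero hm))
  have : Fact (1 < n) := ⟨hn⟩
  have : Fact (1 < m * n) := ⟨hmn⟩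
  have : NeZero n := ⟨by omega⟩
  have : NeZero (m * n) := ⟨by omega⟩
  have hexp := unfoldingSeries_eq_expand (csA (m * n)) (csA n) (foldHom m n) hm length_foldHom
  refine ⟨isAdmissible_foldMap, isLongest_foldGen, foldHom m n, foldHom_simple,
    foldHom_injective, range_foldHom, length_foldHom, hexp, ?_⟩
  -- Both sides are compared after multiplication by this nonzero power, where each becomes `1 - (X
  -- ^ m) ^ n`.
  have h0 : (1 - X ^ m : ℚ⟦X⟧) ^ n ≠ 0 := by
    refine pow_ne_zero _ fun h => ?_
    have := congrArg constantCoeff h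
    simp [hm] at this
  refine mul_right_cancel₀ h0 ?_
  rw [prod_qInt_mul_one_sub_pow m n hm (by omega), hexp]
  have h1 := congrArg (PowerSeries.expand m hm) (poincareSeries_mul_one_sub_X_pow (n := n))
  simpa using h1
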